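/- A queue has a buffer of $B$ bytes. A finite sequence of packets arrives; each packet $p$ has a size $\ell(p)\in\{1,\dots,L\}$ in bytes and requires $r(p)\in\{1,\dots,k\}$ processing cycles. Time is slotted, and each slot consists of three phases: transmission (all buffered packets with no residual processing cycles leave the queue), arrival (the new packets arrive one at a time; each may be admitted or rejected, and buffered packets may be pushed out), and processing (one buffered packet is processed for one cycle). The throughput of an algorithm is the overall size of the packets it transmits, and $\mathrm{OPT}$ is the largest throughput that any (possibly offline, clairvoyant) algorithm, choosing which packets to keep and which packet to process, achieves on the given arrival sequence with a buffer of $B$ bytes. The push-out policy $\mathrm{PO}$ with SRPT (shortest remaining processing time first) priorities keeps its buffer ordered by residual processing cycles, fewest first (ties are broken arbitrarily), and in each slot processes the first packet of the buffer. Each arriving packet is accepted and inserted into the buffer in this order; then, as long as the last packet of the buffer starts above position $B-2L+1$ (byte positions are numbered from $1$, and packets are stored contiguously in buffer order), this last packet is dropped. Theorem. If $L\ge 1$ and $B>2L$, then $\mathrm{PO}$ is at most $\frac{4L-2}{L_a}$-competitive, where $L_a$ is the average size of the packets transmitted by $\mathrm{PO}$: on every finite arrival sequence, $\frac{4L-2}{L_a}\ge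 1$ and $$\mathrm{OPT}\;\le\;\frac{4L-2}{L_a}\cdot\mathrm{throughput}(\mathrm{PO}).$$ (On a sequence without arrivals nothing is transmitted, and the claim is read as $\mathrm{OPT}=0$.) -/

import Mathlib

open scoped ENNReal

namespace PacketQueue

/-- A packet: its size in bytes, and the number of processing cycles it still requires.
An arriving packet carries its initial requirement, a buffered one its residual requirement. -/
structure Packet where
  len : ℕ
  cycles : ℕ

/-- The packet after it has been processed for one cycle. -/
def Packet.tick (p : Packet) : Packet := ⟨p.len, p.cycles - 1⟩

/-- An arrival sequence: the packets arriving in each time slot, in their order of arrival. -/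
abbrev Arrivals := ℕ → List Packet

/-- A finite arrival sequence, all of whose packets have a size in `{1, …, L}` and require a
number of cycles in `{1, …, k}`. -/
def Arrivals.Valid (L k : ℕ) (σ : Arrivals) : Prop :=
  (∃ T, ∀ t, T ≤ t → σ t = []) ∧
    ∀ t, ∀ p ∈ σ t, (1 ≤ p.len ∧ p.len ≤ L) ∧ (1 ≤ p.cycles ∧ p.cycles ≤ k)

/-- Overall length of a collection of packets. -/
def bytes (M : Multiset Packet) : ℕ := (M.map Packet.len).sum

/-- The packets that leave the queue in the transmission phase. -/
def departing (M : Multiset Packet) : Multiset Packet := M.filter fun p => p.cycles = 0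

/-- The packets that stay in the queue after the transmission phase. -/
def remaining (M : Multiset Packet) : Multiset Packet := M.filter fun p => p.cycles ≠ 0

/-! ### Arbitrary (offline, clairvoyant) algorithms with a buffer of `B` bytes -/

/-- Arrival phase of an arbitrary algorithm: the packets arrive one at a time; at each arrival the
algorithm may reject the new packet, and may push out any of the stored ones, and what it keeps has
to fit into `B` bytes. -/
inductive Admits (B : ℕ) : Multiset Packet → List Packet → Multiset Packet → Prop
  | nil (M : Multiset Packet) : Admits B M [] M
  | cons {M N M' : Multiset Packet} {p : Packet} {ps : List Packet} :
      N ≤ p ::ₘ M → bytes N ≤ B → Admits B N ps M' → Admits B M (p :: ps) M'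

/-- Processing phase of an arbitrary algorithm: at most one packet, of its choice, is processed
for one cycle. -/
inductive Processes : Multiset Packet → Multiset Packet → Prop
  | idle (M : Multiset Packet) : Processes M M
  | work (q : Packet) (M : Multiset Packet) : 0 < q.cycles → Processes (q ::ₘ M) (q.tick ::ₘ M)

/-- `S t` is the buffer content at the beginning of slot `t` for some algorithm run on `σ`. Each
slot consists of transmission, arrival, and processing, in this order. -/
def IsSchedule (B : ℕ) (σ : Arrivals) (S : ℕ → Multiset Packet) : Prop :=
  S 0 = 0 ∧ ∀ t, ∃ M, Admits B (remaining (S t)) (σ t) M ∧ Processes M (S (t + 1))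

/-- Overall length of the packets transmitted. -/
noncomputable def throughput (S : ℕ → Multiset Packet) : ℝ≥0∞ :=
  ∑' t, (bytes (departing (S t)) : ℝ≥0∞)

/-- Number of packets transmitted. -/
noncomputable def transmitted (S : ℕ → Multiset Packet) : ℝ≥0∞ :=
  ∑' t, (Multiset.card (departing (S t)) : ℝ≥0∞)

/-- Average length of the packets transmitted. -/
noncomputable def averageLength (S : ℕ → Multiset Packet) : ℝ≥0∞ :=
  throughput S / transmitted S

/-- The value of an optimal offline solution on `σ`. -/
noncomputable def optimum (B : ℕ) (σ : Arrivals) : ℝ≥0∞ :=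
  ⨆ (S : ℕ → Multiset Packet) (_ : IsSchedule B σ S), throughput S

/-- The run `S` transmits at least a `1 / α` fraction of what the optimal solution transmits
on `σ`, where `1 ≤ α`. -/
def CompetitiveOn (B : ℕ) (σ : Arrivals) (S : ℕ → Multiset Packet) (α : ℝ≥0∞) : Prop :=
  1 ≤ α ∧ optimum B σ ≤ α * throughput S

/-! ### The push-out policy with SRPT priorities

The buffer is a list, with the packet of highest priority (head of line) first. -/

/-- The `while` loop of the policy on the reversed buffer: as long as the last packet starts above
position `B - 2L + 1`, it is dropped. Positions are numbered from 1, so the last packet starts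
right after the bytes of all the packets that precede it. -/
def trimRev (L B : ℕ) : List Packet → List Packet
  | [] => []
  | q :: rest => if B - 2 * L + 1 < bytes (rest : Multiset Packet) + 1 then trimRev L B rest
      else q :: rest

/-- The `while` loop of the policy. -/
def trim (L B : ℕ) (l : List Packet) : List Packet := (trimRev L B l.reverse).reverse

/-- Arrival phase of the policy: each arriving packet is accepted, the buffer being ordered by
residual cycles (ties may be broken in any way), and then the loop is executed. -/
inductive POAdmits (L B : ℕ) : List Packet → List Packet → List Packet → Prop
  | nil (l : List Packet) : POAdmits L B l [] l
  | cons {l l' m : List Packet} {p : Packet} {ps : List Packet} :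
      l'.Perm (p :: l) → l'.Pairwise (fun x y => x.cycles ≤ y.cycles) →
      POAdmits L B (trim L B l') ps m → POAdmits L B l (p :: ps) m

/-- Processing phase of the policy: the head-of-line packet is processed. -/
def processHOL : List Packet → List Packet
  | [] => []
  | q :: rest => q.tick :: rest

/-- `P t` is the buffer content of the push-out policy at the beginning of slot `t`, when it is run
on `σ` with SRPT priorities. -/
def IsPORun (L B : ℕ) (σ : Arrivals) (P : ℕ → List Packet) : Prop :=
  P 0 = [] ∧ ∀ t, ∃ l, POAdmits L B ((P t).filter fun p => p.cycles ≠ 0) (σ t) l ∧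
    P (t + 1) = processHOL l

end PacketQueue

open PacketQueue

/-!
Since `averageLength` is `throughput / transmitted`, the claim says that no schedule transmits more
than `4L - 2` bytes per packet transmitted by the policy. The proof gives the constant `3L - 1`,
which is at most `4L - 2`.

Suppose that up to now a schedule has transmitted `O` bytes and stores `M`, while the policy has
transmitted `N` packets and stores `Q`. The invariant `Dominates` says that whatever the schedule
can still transmit with some amount of work, the policy can match with at most as much work: for
every part `A` of `M` there is a part `C` of `Q` that requires at most as many cycles in total, with
`O + bytes A ≤ (3L - 1) (N + card C)`. For `A = 0` right after a transmission phase this is the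
desired comparison of what has been transmitted.

Transmission just moves completed packets into `O` and `N`, and an arriving packet can be added
to both `A` and `C`. A processing step lowers the work of `A` by at most one cycle, and because
the policy serves a packet with the fewest residual cycles, it lowers the work of a suitable
nonempty `C` by one cycle, too (`exists_le_tick_cons`). The only delicate step is the loss of the
last packet `q` of the policy (`Dominates.drop_last`). If `C` uses `q`, then `q` can be replaced by
any unused packet, which is no more expensive. If there is no unused packet, then `C` may be
replaced by the whole rest of the buffer; this rest has more than `B - 2L` bytes, hence some
`n ≥ 1` packets with `B ≤ nL + 2L - 1 ≤ (3L - 1) n`, which accounts for all that the schedule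
can store.
-/

namespace PacketQueue

/-! ### Total residual work -/

/-- Total number of residual cycles of a collection of packets. -/
def work (M : Multiset Packet) : ℕ := (M.map Packet.cycles).sum

@[simp] lemma work_zero : work 0 = 0 := rfl

@[simp] lemma work_cons (p : Packet) (M : Multiset Packet) :
    work (p ::ₘ M) = p.cycles + work M := by simp [work]

@[simp] lemma bytes_zero : bytes 0 = 0 := rfl

@[simp] lemma bytes_cons (p : Packet) (M : Multiset Packet) :
    bytes (p ::ₘ M) = p.len + bytes M := by simp [bytes]

lemma work_add (M N : Multiset Packet) : work (M + N) = work M + work N := by simp [work]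

lemma bytes_add (M N : Multiset Packet) : bytes (M + N) = bytes M + bytes N := by simp [bytes]

lemma bytes_mono {M N : Multiset Packet} (h : M ≤ N) : bytes M ≤ bytes N := by
  obtain ⟨D, rfl⟩ := Multiset.le_iff_exists_add.1 h
  simp [bytes_add]

lemma bytes_le_mul_card {L : ℕ} {M : Multiset Packet} (h : ∀ p ∈ M, p.len ≤ L) :
    bytes M ≤ L * Multiset.card M := by
  have := Multiset.sum_le_card_nsmul (M.map Packet.len) L (by simpa using h)
  simpa [bytes, mul_comm] using this

lemma card_le_bytes {M : Multiset Packet} (h : ∀ p ∈ M, 1 ≤ p.len) :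
    Multiset.card M ≤ bytes M := by
  have := Multiset.card_nsmul_le_sum (s := M.map Packet.len) (a := 1) (by simpa using h)
  simpa [bytes] using this

lemma departing_add_remaining (M : Multiset Packet) : departing M + remaining M = M :=
  Multiset.filter_add_not _ _

lemma work_departing (M : Multiset Packet) : work (departing M) = 0 := by
  refine Multiset.sum_eq_zero fun c hc => ?_
  obtain ⟨x, hx, rfl⟩ := Multiset.mem_map.1 hc
  exact (Multiset.mem_filter.1 hx).2

/-- If `h` has the fewest residual cycles, then processing it saves one cycle for some collection
with as many packets as `C`. -/
lemma exists_le_tick_cons {h : Packet} {R C : Multiset Packet} (hh : 1 ≤ h.cycles)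
    (hmin : ∀ x ∈ R, h.cycles ≤ x.cycles) (hC : C ≤ h ::ₘ R) (hC0 : C ≠ 0) :
    ∃ C' ≤ h.tick ::ₘ R, Multiset.card C' = Multiset.card C ∧ work C' + 1 ≤ work C := by
  classical
  obtain ⟨c, D, rfl, hD, hc⟩ : ∃ c D, C = c ::ₘ D ∧ D ≤ R ∧ h.cycles ≤ c.cycles := by
    by_cases hmem : h ∈ C
    · exact ⟨h, C.erase h, (Multiset.cons_erase hmem).symm,
        Multiset.erase_le_iff_le_cons.2 hC, le_rfl⟩
    · have hCR : C ≤ R := (Multiset.le_cons_of_notMem hmem).1 hC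
      obtain ⟨c, hcC⟩ := Multiset.exists_mem_of_ne_zero hC0
      exact ⟨c, C.erase c, (Multiset.cons_erase hcC).symm,
        (Multiset.erase_le _ _).trans hCR, hmin c (Multiset.mem_of_le hCR hcC)⟩
  refine ⟨h.tick ::ₘ D, Multiset.cons_le_cons _ hD, by simp, ?_⟩
  simp only [work_cons, Packet.tick]
  omega

/-! ### The invariant -/

/-- A schedule that has transmitted `O` bytes and stores `M` is dominated, with factor `K`, by a
policy that has transmitted `N` packets and stores `Q`: every part `A` of `M` is matched by a part
of `Q` that requires no more work. -/
def Dominates (K O : ℕ) (M : Multiset Packet) (N : ℕ) (Q : Multiset Packet) : Prop :=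
  ∀ A ≤ M, ∃ C ≤ Q, work C ≤ work A ∧ O + bytes A ≤ K * (N + Multiset.card C)

namespace Dominates

variable {K O N : ℕ} {M Q : Multiset Packet}

lemma transmit (h : Dominates K O M N Q) :
    Dominates K (O + bytes (departing M)) (remaining M)
      (N + Multiset.card (departing Q)) (remaining Q) := by
  intro A hA
  obtain ⟨C, hC, hw, hb⟩ := h (departing M + A)
    ((add_le_add_right hA _).trans_eq (departing_add_remaining M))
  have hCs := departing_add_remaining C
  refine ⟨remaining C, Multiset.filter_le_filter _ hC, ?_, ?_⟩
  · rw [← hCs, work_add, work_add, work_departing, work_departing] at hw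
    simpa using hw
  · have hcard : Multiset.card C ≤
        Multiset.card (departing Q) + Multiset.card (remaining C) := by
      conv_lhs => rw [← hCs, Multiset.card_add]
      gcongr
      exact Multiset.filter_le_filter _ hC
    rw [bytes_add] at hb
    calc _ = O + (bytes (departing M) + bytes A) := by ring
      _ ≤ _ := hb
      _ ≤ _ := Nat.mul_le_mul_left _ (by omega)

lemma mono (h : Dominates K O M N Q) {M' : Multiset Packet} (hM : M' ≤ M) :
    Dominates K O M' N Q := fun A hA => h A (hA.trans hM)

lemma arrive (h : Dominates K O M N Q) {p : Packet} (hp : p.len ≤ K) :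
    Dominates K O (p ::ₘ M) N (p ::ₘ Q) := by
  classical
  intro A hA
  by_cases hpA : p ∈ A
  · obtain ⟨C, hC, hw, hb⟩ := h (A.erase p) (Multiset.erase_le_iff_le_cons.2 hA)
    rw [← Multiset.cons_erase hpA]
    refine ⟨p ::ₘ C, Multiset.cons_le_cons _ hC, by simpa using hw, ?_⟩
    simp only [bytes_cons, Multiset.card_cons]
    linarith
  · obtain ⟨C, hC, hw, hb⟩ := h A ((Multiset.le_cons_of_notMem hpA).1 hA)
    exact ⟨C, hC.trans (Multiset.le_cons_self _ _), hw, hb⟩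

/-- While every packet stored by the policy still needs processing, it matches `A = 0` only by
`C = 0`, so the amounts transmitted so far compare. -/
lemma le_mul (h : Dominates K O M N Q) (hQ : ∀ x ∈ Q, 1 ≤ x.cycles) : O ≤ K * N := by
  obtain ⟨C, hC, hw, hb⟩ := h 0 (Multiset.zero_le _)
  have hC0 : C = 0 := by
    refine Multiset.eq_zero_of_forall_notMem fun x hx => ?_
    have h1 : x.cycles ≤ work C := Multiset.le_sum_of_mem (Multiset.mem_map_of_mem _ hx)
    have h2 := hQ x (Multiset.mem_of_le hC hx)
    simp only [work_zero] at hw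
    omega
  simpa [hC0] using hb

/-- The policy may drop a packet `q` with the most residual cycles if the packets `R` that it
keeps are so many that, at rate `K`, they account for all that the schedule can store. -/
lemma drop_last {q : Packet} {R : Multiset Packet} (h : Dominates K O M N (q ::ₘ R))
    (hpos : ∀ x ∈ q ::ₘ R, 1 ≤ x.cycles) (hmax : ∀ x ∈ R, x.cycles ≤ q.cycles)
    (hfull : bytes M ≤ K * Multiset.card R) : Dominates K O M N R := by
  classical
  intro A hA
  obtain ⟨C, hC, hw, hb⟩ := h A hA
  by_cases hqC : q ∈ C
  · have hDR : C.erase q ≤ R := Multiset.erase_le_iff_le_cons.2 hC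
    rw [← Multiset.cons_erase hqC] at hw hb
    generalize C.erase q = D at hDR hw hb
    simp only [work_cons, Multiset.card_cons] at hw hb
    obtain rfl | hlt := hDR.eq_or_lt
    · -- Every packet of `R` is used already, so all of `R` is affordable.
      refine ⟨D, le_rfl, by omega, ?_⟩
      have hO := h.le_mul hpos
      have hA' := bytes_mono hA
      rw [mul_add]
      omega
    · obtain ⟨r, hr⟩ := Multiset.lt_iff_cons_le.1 hlt
      have hrq := hmax r (Multiset.mem_of_le hr (Multiset.mem_cons_self _ _))
      exact ⟨r ::ₘ D, hr, by simp only [work_cons]; omega, by simpa using hb⟩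
  · exact ⟨C, (Multiset.le_cons_of_notMem hqC).1 hC, hw, hb⟩

end Dominates

/-! ### Arrival and processing phases -/

/-- Every part of the buffer of a schedule after processing comes from a part before processing that
has the same size and needs at most one more cycle. -/
lemma Processes.exists_le {M M' A : Multiset Packet} (h : Processes M M') (hA : A ≤ M') :
    ∃ A₀ ≤ M, bytes A₀ = bytes A ∧ PacketQueue.work A₀ ≤ PacketQueue.work A + 1 := by
  classical
  cases h with
  | idle => exact ⟨A, hA, rfl, by omega⟩
  | work q M hq =>
    by_cases hqA : q.tick ∈ A
    · refine ⟨q ::ₘ A.erase q.tick,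
        Multiset.cons_le_cons _ (Multiset.erase_le_iff_le_cons.2 hA), ?_, ?_⟩ <;>
      conv_rhs => rw [← Multiset.cons_erase hqA]
      · simp [Packet.tick]
      · simp only [work_cons, Packet.tick]
        omega
    · exact ⟨A, ((Multiset.le_cons_of_notMem hqA).1 hA).trans (Multiset.le_cons_self _ _),
        rfl, by omega⟩

/-- Properties of the buffer of the policy between the transmission and the processing phase:
priority order, sizes in `{1, …, L}`, and no completed packet. -/
structure Ordered (L : ℕ) (l : List Packet) : Prop where
  sorted : l.Pairwise fun x y => x.cycles ≤ y.cycles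
  len : ∀ p ∈ l, 1 ≤ p.len ∧ p.len ≤ L
  pos : ∀ p ∈ l, 1 ≤ p.cycles

lemma Ordered.sublist {L : ℕ} {l l' : List Packet} (h : Ordered L l) (hl : l'.Sublist l) :
    Ordered L l' :=
  ⟨h.sorted.sublist hl, fun p hp => h.len p (hl.subset hp), fun p hp => h.pos p (hl.subset hp)⟩

/-- The policy's buffer right after the insertion of an arriving packet. -/
lemma Ordered.insert {L : ℕ} {l l' : List Packet} {p : Packet} (hl : Ordered L l)
    (hp : (1 ≤ p.len ∧ p.len ≤ L) ∧ 1 ≤ p.cycles) (hperm : l'.Perm (p :: l))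
    (hsort : l'.Pairwise fun x y => x.cycles ≤ y.cycles) : Ordered L l' := by
  refine ⟨hsort, fun x hx => ?_, fun x hx => ?_⟩
  all_goals obtain rfl | hx := List.mem_cons.1 (hperm.subset hx)
  exacts [hp.1, hl.len x hx, hp.2, hl.pos x hx]

lemma Dominates.process {K O N L : ℕ} {M M' : Multiset Packet} {l : List Packet}
    (h : Dominates K O M N l) (hl : Ordered L l) (hM : Processes M M') :
    Dominates K O M' N (processHOL l) := by
  intro A hA
  obtain ⟨A₀, hA₀, hb₀, hw₀⟩ := hM.exists_le hA
  obtain ⟨C, hC, hw, hb⟩ := h A₀ hA₀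
  rw [hb₀] at hb
  by_cases hC0 : C = 0
  · exact ⟨0, Multiset.zero_le _, by simp, by simpa [hC0] using hb⟩
  cases l with
  | nil => exact absurd (Multiset.le_zero.1 hC) hC0
  | cons q rest =>
    obtain ⟨C', hC', hcard, hwork⟩ := exists_le_tick_cons (R := rest) (hl.pos q (by simp))
      (fun x hx => (List.pairwise_cons.1 hl.sorted).1 x (by simpa using hx)) hC hC0
    exact ⟨C', hC', by omega, by rwa [hcard]⟩

lemma trimRev_sublist (L B : ℕ) (l : List Packet) : (trimRev L B l).Sublist l := by
  induction l with
  | nil => exact List.Sublist.refl _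
  | cons q rest ih =>
    rw [trimRev]
    split_ifs
    · exact ih.trans (List.sublist_cons_self _ _)
    · exact List.Sublist.refl _

lemma trim_sublist (L B : ℕ) (l : List Packet) : (trim L B l).Sublist l := by
  have := (trimRev_sublist L B l.reverse).reverse
  rwa [List.reverse_reverse] at this

/-- A packet preceded by more than `B - 2L` bytes, as in the loop of the policy, is preceded by at
least `B / (3L - 1)` packets. -/
lemma le_mul_card_of_lt_bytes {L B : ℕ} {R : Multiset Packet} (hL : 1 ≤ L)
    (hR : ∀ x ∈ R, x.len ≤ L) (h : B - 2 * L < bytes R) :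
    B ≤ (3 * L - 1) * Multiset.card R := by
  have hb := bytes_le_mul_card hR
  have hn : 1 ≤ Multiset.card R := by
    by_contra! h0
    rw [Nat.lt_one_iff.1 h0] at hb
    omega
  obtain ⟨n, hn'⟩ := Nat.exists_eq_add_of_le hn
  obtain ⟨j, rfl⟩ := Nat.exists_eq_add_of_le hL
  rw [hn'] at hb ⊢
  have : 3 * (1 + j) - 1 = 3 * j + 2 := by omega
  rw [this]
  have h2 : B + 1 ≤ (1 + j) * (1 + n) + 2 * (1 + j) := by omega
  nlinarith [Nat.zero_le (j * n), Nat.zero_le n]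

lemma Dominates.trimRev {L B O N : ℕ} {M : Multiset Packet} (hL : 1 ≤ L)
    (hM : bytes M ≤ B) (l : List Packet) (hl : Ordered L l.reverse)
    (h : Dominates (3 * L - 1) O M N l) :
    Dominates (3 * L - 1) O M N (PacketQueue.trimRev L B l) := by
  induction l with
  | nil => exact h
  | cons q rest ih =>
    rw [PacketQueue.trimRev]
    split_ifs with hfull
    · have hrest : Ordered L rest.reverse := hl.sublist (by simp)
      have hsorted := List.pairwise_reverse.1 hl.sorted
      refine ih hrest (h.drop_last (fun x hx => hl.pos x (by simpa [or_comm] using hx))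
        (fun x hx => (List.pairwise_cons.1 hsorted).1 x (by simpa using hx)) (hM.trans ?_))
      exact le_mul_card_of_lt_bytes hL
        (fun x hx => (hrest.len x (by simpa using hx)).2) (by omega)
    · exact h

lemma Dominates.trim {L B O N : ℕ} {M : Multiset Packet} (hL : 1 ≤ L)
    (hM : bytes M ≤ B) {l : List Packet} (hl : Ordered L l)
    (h : Dominates (3 * L - 1) O M N l) :
    Dominates (3 * L - 1) O M N (PacketQueue.trim L B l) := by
  have hrev : (l.reverse : Multiset Packet) = l := Multiset.coe_reverse l
  rw [PacketQueue.trim, Multiset.coe_reverse]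
  exact Dominates.trimRev hL hM _ (by rwa [List.reverse_reverse]) (by rwa [hrev])

lemma POAdmits.ordered {L B : ℕ} {l m ps : List Packet} (h : POAdmits L B l ps m)
    (hps : ∀ p ∈ ps, (1 ≤ p.len ∧ p.len ≤ L) ∧ 1 ≤ p.cycles) (hl : Ordered L l) :
    Ordered L m := by
  induction h with
  | nil => exact hl
  | @cons l l' m p ps hperm hsort _ ih =>
    simp only [List.forall_mem_cons] at hps
    exact ih hps.2 ((hl.insert hps.1 hperm hsort).sublist (trim_sublist L B l'))

lemma POAdmits.length_le {L B : ℕ} {l m ps : List Packet} (h : POAdmits L B l ps m) :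
    m.length ≤ l.length + ps.length := by
  induction h with
  | nil => simp
  | @cons l l' m p ps hperm _ _ ih =>
    have h1 := (trim_sublist L B l').length_le
    have h2 := hperm.length_eq
    simp only [List.length_cons] at h2 ⊢
    omega

lemma Dominates.arrival_phase {L B O N : ℕ} {M M' : Multiset Packet} {l m ps : List Packet}
    (hL : 1 ≤ L)
    (hO : Admits B M ps M') (hP : POAdmits L B l ps m)
    (hps : ∀ p ∈ ps, (1 ≤ p.len ∧ p.len ≤ L) ∧ 1 ≤ p.cycles) (hl : Ordered L l)
    (h : Dominates (3 * L - 1) O M N l) : Dominates (3 * L - 1) O M' N m := by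
  induction hO generalizing l with
  | nil =>
    cases hP
    exact h
  | @cons M M₁ M' p ps hM₁ hB _ ih =>
    cases hP with
    | @cons _ l' _ _ _ hperm hsort hP =>
      simp only [List.forall_mem_cons] at hps
      have hl' : Ordered L l' := hl.insert hps.1 hperm hsort
      have harr : Dominates (3 * L - 1) O M₁ N l' := by
        rw [Multiset.coe_eq_coe.2 hperm]
        exact (h.arrive (p := p) (by omega)).mono hM₁
      exact ih hP hps.2 (hl'.sublist (trim_sublist L B l')) (harr.trim hL hB hl')

/-! ### Comparison of complete runs -/

variable {B L k : ℕ} {σ : Arrivals} {P : ℕ → List Packet} {S : ℕ → Multiset Packet}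

lemma Arrivals.Valid.mem (hσ : σ.Valid L k) (t : ℕ) :
    ∀ p ∈ σ t, (1 ≤ p.len ∧ p.len ≤ L) ∧ 1 ≤ p.cycles :=
  fun p hp => ⟨(hσ.2 t p hp).1, (hσ.2 t p hp).2.1⟩

lemma Ordered.processHOL {l : List Packet} (h : Ordered L l) :
    (PacketQueue.processHOL l).Pairwise (fun x y => x.cycles ≤ y.cycles) ∧
      ∀ p ∈ PacketQueue.processHOL l, 1 ≤ p.len ∧ p.len ≤ L := by
  cases l with
  | nil => simp [PacketQueue.processHOL]
  | cons q rest =>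
    have hs := List.pairwise_cons.1 h.sorted
    refine ⟨List.pairwise_cons.2 ⟨fun x hx => (Nat.sub_le _ _).trans (hs.1 x hx), hs.2⟩, ?_⟩
    rintro p hp
    obtain rfl | hp := List.mem_cons.1 hp
    · exact h.len q (by simp)
    · exact h.len p (by simp [hp])

lemma Ordered.filter {l : List Packet} (hs : l.Pairwise fun x y => x.cycles ≤ y.cycles)
    (hlen : ∀ p ∈ l, 1 ≤ p.len ∧ p.len ≤ L) : Ordered L (l.filter fun p => p.cycles ≠ 0) := by
  refine ⟨hs.filter _, fun p hp => hlen p (List.mem_of_mem_filter hp), fun p hp => ?_⟩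
  exact Nat.one_le_iff_ne_zero.2 (of_decide_eq_true (List.mem_filter.1 hp).2)

/-- The beginning of a slot needs a statement weaker than `Ordered`: the packet processed last may
be completed. -/
lemma IsPORun.sorted_and_len (hσ : σ.Valid L k) (hP : IsPORun L B σ P) (t : ℕ) :
    (P t).Pairwise (fun x y => x.cycles ≤ y.cycles) ∧ ∀ p ∈ P t, 1 ≤ p.len ∧ p.len ≤ L := by
  induction t with
  | zero => simp [hP.1]
  | succ t ih =>
    obtain ⟨l, hl, hPt⟩ := hP.2 t
    rw [hPt]
    exact (hl.ordered (hσ.mem t) (Ordered.filter ih.1 ih.2)).processHOL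

lemma coe_filter_cycles (l : List Packet) :
    ((l.filter fun p => p.cycles ≠ 0 : List Packet) : Multiset Packet) = remaining l := by
  simp [remaining]

/-- The invariant at the beginning of each slot, before its transmission phase. -/
theorem dominates_run (hL : 1 ≤ L) (hσ : σ.Valid L k) (hP : IsPORun L B σ P)
    (hS : IsSchedule B σ S) (t : ℕ) :
    Dominates (3 * L - 1) (∑ s ∈ Finset.range t, bytes (departing (S s))) (S t)
      (∑ s ∈ Finset.range t, Multiset.card (departing (P s))) (P t) := by
  induction t with
  | zero =>
    intro A hA
    rw [hS.1, Multiset.le_zero] at hA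
    exact ⟨0, Multiset.zero_le _, by simp, by simp [hA]⟩
  | succ t ih =>
    obtain ⟨M, hM, hproc⟩ := hS.2 t
    obtain ⟨l, hl, hPt⟩ := hP.2 t
    have hord := Ordered.filter (hP.sorted_and_len hσ t).1 (hP.sorted_and_len hσ t).2
    have h := ih.transmit
    rw [← coe_filter_cycles] at h
    rw [Finset.sum_range_succ, Finset.sum_range_succ, hPt]
    exact (h.arrival_phase hL hM hl (hσ.mem t) hord).process (hl.ordered (hσ.mem t) hord) hproc

lemma sum_bytes_le (hL : 1 ≤ L) (hσ : σ.Valid L k) (hP : IsPORun L B σ P)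
    (hS : IsSchedule B σ S) (t : ℕ) :
    ∑ s ∈ Finset.range t, bytes (departing (S s)) ≤
      (3 * L - 1) * ∑ s ∈ Finset.range t, Multiset.card (departing (P s)) := by
  cases t with
  | zero => simp
  | succ t =>
    have h := (dominates_run hL hσ hP hS t).transmit.le_mul
      (fun x hx => Nat.one_le_iff_ne_zero.2 (Multiset.mem_filter.1 hx).2)
    rwa [← Finset.sum_range_succ, ← Finset.sum_range_succ] at h

lemma throughput_le_mul_transmitted (hL : 1 ≤ L) (hσ : σ.Valid L k) (hP : IsPORun L B σ P)
    (hS : IsSchedule B σ S) :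
    throughput S ≤ ((3 * L - 1 : ℕ) : ℝ≥0∞) * transmitted fun t => (P t : Multiset Packet) := by
  refine ENNReal.tsum_le_of_sum_range_le fun t => ?_
  calc ∑ s ∈ Finset.range t, (bytes (departing (S s)) : ℝ≥0∞)
      ≤ ((3 * L - 1 : ℕ) : ℝ≥0∞) *
        ∑ s ∈ Finset.range t, (Multiset.card (departing (P s)) : ℝ≥0∞) :=
        mod_cast sum_bytes_le hL hσ hP hS t
    _ ≤ _ := by
      gcongr
      exact ENNReal.sum_le_tsum _

/-- The policy transmits and stores no more packets than have arrived. -/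
lemma IsPORun.sum_card_add_length_le (hP : IsPORun L B σ P) (t : ℕ) :
    ∑ s ∈ Finset.range t, Multiset.card (departing (P s)) + (P t).length ≤
      ∑ s ∈ Finset.range t, (σ s).length := by
  induction t with
  | zero => simp [hP.1]
  | succ t ih =>
    obtain ⟨l, hl, hPt⟩ := hP.2 t
    have h1 := hl.length_le
    have h2 : (processHOL l).length = l.length := by cases l <;> rfl
    have h3 := congrArg Multiset.card (departing_add_remaining (P t))
    rw [Multiset.card_add, ← coe_filter_cycles, Multiset.coe_card, Multiset.coe_card] at h3
    rw [Finset.sum_range_succ, Finset.sum_range_succ, hPt, h2]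
    omega

lemma IsPORun.transmitted_ne_top (hσ : σ.Valid L k) (hP : IsPORun L B σ P) :
    transmitted (fun t => (P t : Multiset Packet)) ≠ ⊤ := by
  obtain ⟨T, hT⟩ := hσ.1
  refine ne_top_of_le_ne_top
    (ENNReal.natCast_ne_top (∑ s ∈ Finset.range T, (σ s).length))
    (ENNReal.tsum_le_of_sum_range_le fun t => ?_)
  have h : ∑ s ∈ Finset.range t, (σ s).length ≤ ∑ s ∈ Finset.range T, (σ s).length := by
    refine Finset.sum_le_sum_of_ne_zero fun s _ hs => Finset.mem_range.2 ?_
    by_contra! hTs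
    exact hs (by simp [hT s hTs])
  exact_mod_cast (Nat.le_of_add_right_le (hP.sum_card_add_length_le t)).trans h

lemma IsPORun.transmitted_le_throughput (hσ : σ.Valid L k) (hP : IsPORun L B σ P) :
    transmitted (fun t => (P t : Multiset Packet)) ≤
      throughput fun t => (P t : Multiset Packet) :=
  ENNReal.tsum_le_tsum fun t => Nat.cast_le.2 <| card_le_bytes fun p hp =>
    ((hP.sorted_and_len hσ t).2 p (Multiset.mem_of_mem_filter hp)).1

lemma IsPORun.throughput_le (hσ : σ.Valid L k) (hP : IsPORun L B σ P) :
    throughput (fun t => (P t : Multiset Packet)) ≤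
      L * transmitted fun t => (P t : Multiset Packet) := by
  rw [throughput, transmitted, ← ENNReal.tsum_mul_left]
  exact ENNReal.tsum_le_tsum fun t => mod_cast bytes_le_mul_card fun p hp =>
    ((hP.sorted_and_len hσ t).2 p (Multiset.mem_of_mem_filter hp)).2

end PacketQueue

theorem theorem4 (B L k : ℕ) (hL : 1 ≤ L) (hB : 2 * L < B)
    (σ : Arrivals) (hσ : σ.Valid L k) (P : ℕ → List Packet) (hP : IsPORun L B σ P) :
    CompetitiveOn B σ (fun t => (P t : Multiset Packet))
      ((4 * (L : ℝ≥0∞) - 2) / averageLength (fun t => (P t : Multiset Packet))) := by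
  have hT := hP.transmitted_le_throughput hσ
  have hTL := hP.throughput_le hσ
  have hfin := hP.transmitted_ne_top hσ
  have hopt : optimum B σ ≤
      ((3 * L - 1 : ℕ) : ℝ≥0∞) * transmitted fun t => (P t : Multiset Packet) :=
    iSup₂_le fun S hS => throughput_le_mul_transmitted hL hσ hP hS
  have hc : (4 * (L : ℝ≥0∞) - 2) = ((4 * L - 2 : ℕ) : ℝ≥0∞) := by
    rw [ENNReal.natCast_sub]
    norm_num
  rw [hc, averageLength, CompetitiveOn]
  generalize transmitted (fun t => (P t : Multiset Packet)) = n at hT hTL hfin hopt ⊢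
  generalize throughput (fun t => (P t : Multiset Packet)) = T at hT hTL ⊢
  have hTfin : T ≠ ⊤ :=
    ne_top_of_le_ne_top (ENNReal.mul_ne_top (ENNReal.natCast_ne_top L) hfin) hTL
  have hc0 : ((4 * L - 2 : ℕ) : ℝ≥0∞) ≠ 0 := Nat.cast_ne_zero.2 (by omega)
  constructor
  · have havg : T / n ≤ ((4 * L - 2 : ℕ) : ℝ≥0∞) :=
      (ENNReal.div_le_of_le_mul hTL).trans (Nat.cast_le.2 (by omega))
    rw [ENNReal.le_div_iff_mul_le (Or.inr hc0) (Or.inr (ENNReal.natCast_ne_top _)), one_mul]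
    exact havg
  · refine hopt.trans ?_
    -- If nothing is transmitted, the ratio has no meaning, but `hopt` makes the optimum vanish.
    obtain rfl | hn0 := eq_or_ne n 0
    · simp
    have hT0 : T ≠ 0 := fun h => hn0 (le_zero_iff.1 (h ▸ hT))
    calc ((3 * L - 1 : ℕ) : ℝ≥0∞) * n ≤ ((4 * L - 2 : ℕ) : ℝ≥0∞) * n := by
          gcongr ?_ * n
          exact Nat.cast_le.2 (by omega)
      _ = ((4 * L - 2 : ℕ) : ℝ≥0∞) / (T / n) * T := by
          rw [div_eq_mul_inv _ (T / n), ENNReal.inv_div (Or.inl hfin) (Or.inl hn0), mul_assoc,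
            ENNReal.div_mul_cancel hT0 hTfin]
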